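/- All systems are finite-dimensional, and the operators of a system $A$ are the complex $|A|\times|A|$ matrices. A subnormalized state on $A$ is a matrix $\tilde\rho\ge 0$ with ${\rm Tr}[\tilde\rho]\le 1$, a density matrix is a matrix $\rho\ge 0$ with ${\rm Tr}[\rho]=1$, and a (normalized) pure state is $|\psi\rangle\langle\psi|$ with $\|\psi\|=1$. Let $\|X\|_1={\rm Tr}\sqrt{X^\dagger X}$, and let $D(\rho,\sigma)=\frac12\|\rho-\sigma\|_1$ be the trace distance. For subnormalized states $\tilde\rho,\tilde\sigma$ on $A$ let $$\bar F(\tilde\rho,\tilde\sigma)=\big\|\sqrt{\tilde\rho}\sqrt{\tilde\sigma}\big\|_1+\sqrt{(1-{\rm Tr}[\tilde\rho])(1-{\rm Tr}[\tilde\sigma])},\qquad P(\tilde\rho,\tilde\sigma)=\sqrt{1-\bar F(\tilde\rho,\tilde\sigma)^2}$$ be the generalized fidelity and the purified distance. The maximal extension of the trace distance from normalized pure states to subnormalized states is $$\overline D(\tilde\rho,\tilde\sigma)=\inf D(\psi,\phi),$$ where the infimum is over all systems $R$ and all normalized pure states $\psi,\phi$ on $R$ for which there is a trace non-increasing completely positive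 map $\mathcal E$ from $R$ to $A$ with $\mathcal E(\psi)=\tilde\rho$ and $\mathcal E(\phi)=\tilde\sigma$ (and the infimum is $+\infty$ if there are none). **Corollary.** 1. $\overline D(\tilde\rho,\tilde\sigma)=P(\tilde\rho,\tilde\sigma)$ for every system $A$ and all subnormalized states $\tilde\rho,\tilde\sigma$ on $A$. 2. Let $M$ assign a value in $[-\infty,+\infty]$ to every pair of subnormalized states on a common system. Suppose that $M(\mathcal E(\tilde\rho),\mathcal E(\tilde\sigma))\le M(\tilde\rho,\tilde\sigma)$ for all trace non-increasing completely positive maps $\mathcal E$, and that $M(\psi,\phi)=D(\psi,\phi)$ for all normalized pure states $\psi,\phi$ on a common system. Then $M(\tilde\rho,\tilde\sigma)\le P(\tilde\rho,\tilde\sigma)$ for all subnormalized states $\tilde\rho,\tilde\sigma$ on a common system. 3. Let $M$ assign a value in $[-\infty,+\infty]$ to every pair of density matrices on a common system. Suppose that $M(\mathcal E(\rho),\mathcal E(\sigma))\le M(\rho,\sigma)$ for all completely positive trace-preserving maps $\mathcal E$, and that $M(\psi,\phi)=D(\psi,\phi)$ for all pure states $\psi,\phi$ on a common system. Then $M(\rho,\sigma)\le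 P(\rho,\sigma)$ for all density matrices $\rho,\sigma$ on a common system. -/

import Mathlib

open scoped ComplexOrder MatrixOrder

universe u

namespace QState

/-! A finite-dimensional quantum system is given by a finite index type `A` (an orthonormal basis of
its Hilbert space); its operators are the matrices `Matrix A A ℂ`. -/

section States

variable {A : Type u} [Fintype A]

/-- Subnormalized states: positive semidefinite matrices of trace at most one. -/
def IsSubnormalized (ρ : Matrix A A ℂ) : Prop :=
  ρ.PosSemidef ∧ ρ.trace.re ≤ 1

/-- Normalized states (density matrices): positive semidefinite matrices of trace one. -/
def IsDensity (ρ : Matrix A A ℂ) : Prop :=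
  ρ.PosSemidef ∧ ρ.trace = 1

/-- Normalized pure states: the rank-one projections `|v⟩⟨v|` of the unit vectors `v`. -/
def IsPure (ψ : Matrix A A ℂ) : Prop :=
  ∃ v : A → ℂ, star v ⬝ᵥ v = 1 ∧ ψ = Matrix.vecMulVec v (star v)

end States

section Distances

variable {A : Type u} [Fintype A] [DecidableEq A]

/-- The trace norm `‖X‖₁ = Tr |X|`, where `|X| = √(X† X)`. -/
noncomputable def traceNorm (X : Matrix A A ℂ) : ℝ :=
  (CFC.abs X).trace.re

/-- The trace distance `½ ‖ρ - σ‖₁`. -/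
noncomputable def traceDistance (ρ σ : Matrix A A ℂ) : ℝ :=
  traceNorm (ρ - σ) / 2

/-- The fidelity `‖√ρ √σ‖₁`. -/
noncomputable def fidelity (ρ σ : Matrix A A ℂ) : ℝ :=
  traceNorm (CFC.sqrt ρ * CFC.sqrt σ)

/-- The generalized fidelity `‖√ρ √σ‖₁ + √((1 - Tr ρ) (1 - Tr σ))` of subnormalized states. -/
noncomputable def generalizedFidelity (ρ σ : Matrix A A ℂ) : ℝ :=
  fidelity ρ σ + √((1 - ρ.trace.re) * (1 - σ.trace.re))

/-- The purified distance of subnormalized states. -/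
noncomputable def purifiedDistance (ρ σ : Matrix A A ℂ) : ℝ :=
  √(1 - generalizedFidelity ρ σ ^ 2)

end Distances

section Maps

open scoped CStarAlgebra Matrix.Norms.L2Operator

variable {A B : Type u} [Fintype A] [DecidableEq A] [Fintype B] [DecidableEq B]

/-- A completely positive map is trace non-increasing if `Tr E(X) ≤ Tr X` for all `X ≥ 0`. -/
def IsTraceNonincreasing (E : Matrix A A ℂ →CP Matrix B B ℂ) : Prop :=
  ∀ X : Matrix A A ℂ, X.PosSemidef → (E X).trace.re ≤ X.trace.re

/-- A completely positive map is trace preserving (hence a quantum channel) if `Tr E(X) = Tr X`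
for all `X`. -/
def IsTracePreserving (E : Matrix A A ℂ →CP Matrix B B ℂ) : Prop :=
  ∀ X : Matrix A A ℂ, (E X).trace = X.trace

end Maps

section Extension

open scoped CStarAlgebra Matrix.Norms.L2Operator

/-- The maximal extension, from pairs of normalized pure states to pairs of subnormalized states, of
a function `D₁` of two states: the infimum of `D₁ ψ φ` over all systems `R` and all pairs of
normalized pure states `ψ`, `φ` on `R` that some trace non-increasing completely positive map sends
to `ρ` and `σ` simultaneously. It is `⊤` if there is no such pair. -/
noncomputable def maximalExtension
    (D₁ : ∀ (R : Type u) [Fintype R] [DecidableEq R], Matrix R R ℂ → Matrix R R ℂ → ℝ)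
    {A : Type u} [Fintype A] [DecidableEq A] (ρ σ : Matrix A A ℂ) : EReal :=
  sInf {x : EReal | ∃ (R : Type u) (_ : Fintype R) (_ : DecidableEq R) (ψ φ : Matrix R R ℂ)
    (E : Matrix R R ℂ →CP Matrix A A ℂ),
    IsPure ψ ∧ IsPure φ ∧ IsTraceNonincreasing E ∧ E ψ = ρ ∧ E φ = σ ∧ x = (D₁ R ψ φ : EReal)}

variable (M : ∀ (A : Type u) [Fintype A] [DecidableEq A], Matrix A A ℂ → Matrix A A ℂ → EReal)

/-- The data processing inequality for a function of two subnormalized states: it does not increase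
under trace non-increasing completely positive maps. -/
def SubnormalizedDPI : Prop :=
  ∀ (A B : Type u) [Fintype A] [DecidableEq A] [Fintype B] [DecidableEq B]
    (E : Matrix A A ℂ →CP Matrix B B ℂ), IsTraceNonincreasing E →
    ∀ ρ σ : Matrix A A ℂ, IsSubnormalized ρ → IsSubnormalized σ → M B (E ρ) (E σ) ≤ M A ρ σ

/-- The data processing inequality for a function of two density matrices: it does not increase
under quantum channels. -/
def NormalizedDPI : Prop :=
  ∀ (A B : Type u) [Fintype A] [DecidableEq A] [Fintype B] [DecidableEq B]
    (E : Matrix A A ℂ →CP Matrix B B ℂ), IsTracePreserving E →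
    ∀ ρ σ : Matrix A A ℂ, IsDensity ρ → IsDensity σ → M B (E ρ) (E σ) ≤ M A ρ σ

/-- `M` coincides with the trace distance on pairs of normalized pure states. -/
def ReducesToTraceDistance : Prop :=
  ∀ (R : Type u) [Fintype R] [DecidableEq R] (ψ φ : Matrix R R ℂ), IsPure ψ → IsPure φ →
    M R ψ φ = (traceDistance ψ φ : EReal)

end Extension

end QState

/-! Pure states satisfy `D(ψ, φ) = √(1 - |⟨v|w⟩|²)`, so everything reduces to comparing overlaps
with the generalized fidelity. Achievability: Uhlmann's theorem gives `P Pᴴ = ρ`, `Q Qᴴ = σ` with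
`Tr Pᴴ Q` the fidelity. Read as vectors and extended by one coordinate that carries the missing
trace, they become unit vectors whose overlap is the generalized fidelity. Dropping that coordinate
and tracing out one factor recovers `ρ` and `σ`. Data processing along this map bounds any `M`.
Optimality (`norm_inner_le_generalizedFidelity`): split the overlap into `Tr E(|v⟩⟨w|)` and a
remainder. 2-positivity of `E` and Uhlmann bound the first by the fidelity; Cauchy–Schwarz for the
positive functional `Tr X - Tr E(X)` bounds the second by the square-root term. -/

namespace QState

open Matrix

/-! ### Trace norm, Uhlmann's theorem and the trace distance of pure states. -/

section MatrixLemmas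

variable {m n : Type*} [Fintype m] [Fintype n]

/-- The Cauchy–Schwarz inequality for the Hilbert–Schmidt inner product. -/
theorem norm_trace_conjTranspose_mul_le (P Q : Matrix m n ℂ) :
    ‖(Pᴴ * Q).trace‖ ≤ √(Pᴴ * P).trace.re * √(Qᴴ * Q).trace.re := by
  let f : Matrix m n ℂ → EuclideanSpace ℂ (n × m) := fun P ↦ WithLp.toLp 2 fun x ↦ P x.2 x.1
  have h (P Q : Matrix m n ℂ) : inner ℂ (f P) (f Q) = (Pᴴ * Q).trace := by
    simp [f, EuclideanSpace.inner_toLp_toLp, Matrix.trace, Matrix.mul_apply, dotProduct,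
      Fintype.sum_prod_type, mul_comm]
  have hn (P : Matrix m n ℂ) : ‖f P‖ = √(Pᴴ * P).trace.re := by
    rw [← h, norm_eq_sqrt_re_inner (𝕜 := ℂ)]; rfl
  rw [← h, ← hn, ← hn]
  exact norm_inner_le_norm _ _

/-- Two matrices with the same Gram matrix differ by a unitary on the left. -/
theorem exists_unitary_mul_eq [DecidableEq m] [DecidableEq n] {P Q : Matrix m n ℂ}
    (h : Pᴴ * P = Qᴴ * Q) : ∃ U : Matrix m m ℂ, Uᴴ * U = 1 ∧ P = U * Q := by
  set p := toEuclideanLin P with hp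
  set q := toEuclideanLin Q with hq
  have hin (R : Matrix m n ℂ) (x : EuclideanSpace ℂ n) :
      inner ℂ (toEuclideanLin R x) (toEuclideanLin R x)
        = inner ℂ x (toEuclideanLin (Rᴴ * R) x) := by
    rw [toLpLin_mul (q := 2), toEuclideanLin_conjTranspose_eq_adjoint, LinearMap.comp_apply,
      LinearMap.adjoint_inner_right]
  have hnorm (x : EuclideanSpace ℂ n) : ‖p x‖ = ‖q x‖ := by
    rw [norm_eq_sqrt_re_inner (𝕜 := ℂ), norm_eq_sqrt_re_inner (𝕜 := ℂ), hin, hin, h]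
  have hker : LinearMap.ker q ≤ LinearMap.ker p := fun x hx ↦ by
    rw [LinearMap.mem_ker] at hx ⊢
    rw [← norm_eq_zero, hnorm, hx, norm_zero]
  -- The map `q x ↦ p x` is well defined and isometric on the range of `q`; finite dimension lets it
  -- extend to the whole space.
  let l : LinearMap.range q →ₗ[ℂ] EuclideanSpace ℂ m :=
    (LinearMap.ker q).liftQ p hker ∘ₗ q.quotKerEquivRange.symm.toLinearMap
  have hl (x : EuclideanSpace ℂ n) : l ⟨q x, x, rfl⟩ = p x := by
    have : q.quotKerEquivRange.symm ⟨q x, x, rfl⟩ = (LinearMap.ker q).mkQ x :=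
      q.quotKerEquivRange_symm_apply_image x _
    simp [l, this]
  let L : LinearMap.range q →ₗᵢ[ℂ] EuclideanSpace ℂ m :=
    ⟨l, by rintro ⟨_, x, rfl⟩; rw [hl, hnorm]; rfl⟩
  let u := L.extend
  refine ⟨toEuclideanLin.symm u.toLinearMap, ?_, ?_⟩
  · apply toEuclideanLin.injective
    rw [toLpLin_mul (q := 2), toEuclideanLin_conjTranspose_eq_adjoint, LinearEquiv.apply_symm_apply]
    ext1 x
    refine ext_inner_left ℂ fun y ↦ ?_
    rw [LinearMap.comp_apply, LinearMap.adjoint_inner_right]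
    simp
  · apply toEuclideanLin.injective
    rw [toLpLin_mul (q := 2), LinearEquiv.apply_symm_apply]
    ext1 x
    have := L.extend_apply ⟨q x, x, rfl⟩
    exact (this.trans (hl x)).symm

theorem sqrt_conjTranspose [DecidableEq n] (ρ : Matrix n n ℂ) : (CFC.sqrt ρ)ᴴ = CFC.sqrt ρ :=
  (CFC.sqrt_nonneg ρ).posSemidef.isHermitian

theorem sqrt_conjTranspose_mul_self [DecidableEq n] {ρ : Matrix n n ℂ} (h : ρ.PosSemidef) :
    (CFC.sqrt ρ)ᴴ * CFC.sqrt ρ = ρ := by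
  rw [sqrt_conjTranspose, CFC.sqrt_mul_sqrt_self ρ h.nonneg]

/-- The polar decomposition. -/
theorem exists_unitary_mul_abs [DecidableEq n] (X : Matrix n n ℂ) :
    ∃ U : Matrix n n ℂ, Uᴴ * U = 1 ∧ X = U * CFC.abs X := by
  refine exists_unitary_mul_eq ?_
  have h : (CFC.abs X)ᴴ = CFC.abs X := (CFC.abs_nonneg X).posSemidef.isHermitian
  rw [h, CFC.abs_mul_abs, star_eq_conjTranspose]

theorem trace_abs_eq [DecidableEq n] (X : Matrix n n ℂ) : (CFC.abs X).trace = traceNorm X :=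
  Complex.ext rfl (Complex.nonneg_iff.1 (CFC.abs_nonneg X).posSemidef.trace_nonneg).2.symm

theorem exists_unitary_trace_mul_eq [DecidableEq n] (X : Matrix n n ℂ) :
    ∃ U : Matrix n n ℂ, U * Uᴴ = 1 ∧ (X * U).trace = traceNorm X := by
  obtain ⟨U, hU, hX⟩ := exists_unitary_mul_abs X
  refine ⟨Uᴴ, by rwa [conjTranspose_conjTranspose], ?_⟩
  conv_lhs => rw [hX]
  rw [Matrix.trace_mul_comm, ← Matrix.mul_assoc, hU, one_mul, trace_abs_eq]

/-- Cauchy–Schwarz after splitting `|X|` as `S * S`. General contractions `K` are allowed because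
Uhlmann's bound uses a corner of a unitary. -/
theorem norm_trace_mul_le_traceNorm [DecidableEq n] (X K : Matrix n n ℂ)
    (hK : (1 - K * Kᴴ).PosSemidef) : ‖(X * K).trace‖ ≤ traceNorm X := by
  obtain ⟨U, hU, hX⟩ := exists_unitary_mul_abs X
  set S := CFC.sqrt (CFC.abs X)
  have hS : Sᴴ = S := sqrt_conjTranspose _
  have hSS : S * S = CFC.abs X := CFC.sqrt_mul_sqrt_self _ (CFC.abs_nonneg X)
  have h0 : 0 ≤ traceNorm X := (Complex.nonneg_iff.1 (CFC.abs_nonneg X).posSemidef.trace_nonneg).1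
  have h2 : (X * K).trace = ((S * Uᴴ)ᴴ * (S * K)).trace := by
    conv_lhs => rw [hX, ← hSS]
    simp only [conjTranspose_mul, conjTranspose_conjTranspose, hS, Matrix.mul_assoc]
  have h3 : ((S * Uᴴ)ᴴ * (S * Uᴴ)).trace.re = traceNorm X := by
    rw [conjTranspose_mul, conjTranspose_conjTranspose, hS, Matrix.trace_mul_comm,
      Matrix.mul_assoc, ← Matrix.mul_assoc Uᴴ, hU, one_mul, hSS]; rfl
  have h4 : ((S * K)ᴴ * (S * K)).trace.re ≤ traceNorm X := by
    have := (Complex.nonneg_iff.1 (hK.mul_mul_conjTranspose_same S).trace_nonneg).1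
    rw [hS, mul_sub, sub_mul, mul_one, hSS, trace_sub, Complex.sub_re] at this
    rw [Matrix.trace_mul_comm, conjTranspose_mul, hS]
    simp only [← Matrix.mul_assoc] at this ⊢
    exact sub_nonneg.1 this
  rw [h2]
  calc _ ≤ _ := norm_trace_conjTranspose_mul_le _ _
    _ ≤ √(traceNorm X) * √(traceNorm X) := by rw [h3]; gcongr
    _ = _ := Real.mul_self_sqrt h0

/-- The easy direction of Uhlmann's theorem. -/
theorem norm_trace_conjTranspose_mul_le_fidelity [DecidableEq m] [DecidableEq n]
    (P Q : Matrix m n ℂ) :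
    ‖(Pᴴ * Q).trace‖ ≤ fidelity (Pᴴ * P) (Qᴴ * Q) := by
  set ρ := Pᴴ * P with hρ
  set σ := Qᴴ * Q with hσ
  -- Zero padding gives `P` and `√(Pᴴ P)` the same shape, so equal Gram matrices yield a unitary
  -- even for rectangular `P`.
  have key (P : Matrix m n ℂ) : ∃ U : Matrix (m ⊕ n) (m ⊕ n) ℂ, Uᴴ * U = 1 ∧
      fromRows P (0 : Matrix n n ℂ) = U * fromRows (0 : Matrix m n ℂ) (CFC.sqrt (Pᴴ * P)) := by
    apply exists_unitary_mul_eq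
    simp only [conjTranspose_fromRows_eq_fromCols_conjTranspose, fromCols_mul_fromRows]
    rw [sqrt_conjTranspose_mul_self (posSemidef_conjTranspose_mul_self P)]
    simp
  obtain ⟨U, hU, hP⟩ := key P
  obtain ⟨V, hV, hQ⟩ := key Q
  set W := Uᴴ * V with hW
  have hWW : W.toBlocks₂₂ᴴ * W.toBlocks₂₂ + W.toBlocks₁₂ᴴ * W.toBlocks₁₂ = 1 := by
    have hU' : U * Uᴴ = 1 := mul_eq_one_comm.1 hU
    have : Wᴴ * W = 1 := by
      rw [hW, conjTranspose_mul, conjTranspose_conjTranspose, Matrix.mul_assoc,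
        ← Matrix.mul_assoc U, hU', one_mul, hV]
    rw [← fromBlocks_toBlocks W, fromBlocks_conjTranspose, fromBlocks_multiply,
      ← fromBlocks_one, fromBlocks_inj] at this
    rw [add_comm]; exact this.2.2.2
  have hPQ : Pᴴ * Q = CFC.sqrt ρ * (W.toBlocks₂₂ * CFC.sqrt σ) := by
    have : (fromRows P (0 : Matrix n n ℂ))ᴴ * fromRows Q (0 : Matrix n n ℂ) = Pᴴ * Q := by
      simp [conjTranspose_fromRows_eq_fromCols_conjTranspose, fromCols_mul_fromRows]
    rw [← this, hP, hQ, conjTranspose_mul, Matrix.mul_assoc, ← Matrix.mul_assoc Uᴴ, ← hW,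
      ← fromBlocks_toBlocks W]
    simp [conjTranspose_fromRows_eq_fromCols_conjTranspose, fromCols_mul_fromRows,
      fromBlocks_mul_fromRows, sqrt_conjTranspose, hρ, hσ]
  have htr : (Pᴴ * Q).trace = star ((CFC.sqrt ρ * CFC.sqrt σ) * W.toBlocks₂₂ᴴ).trace := by
    rw [← trace_conjTranspose, hPQ]
    simp only [conjTranspose_mul, conjTranspose_conjTranspose, sqrt_conjTranspose]
    rw [trace_mul_comm, Matrix.mul_assoc]
  rw [htr, norm_star]
  apply norm_trace_mul_le_traceNorm
  rw [conjTranspose_conjTranspose, ← hWW, add_sub_cancel_left]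
  exact posSemidef_conjTranspose_mul_self _

/-- The eigenvalues lie in `{0, ±√s}`, so `|X| = X² / √s` when `s > 0`. A difference of two pure
states has this form with `s = 1 - |⟨v|w⟩|²`. -/
theorem traceNorm_of_cube_eq [DecidableEq n] {X : Matrix n n ℂ} (hX : X.IsHermitian) {s : ℝ}
    (hs : 0 ≤ s) (h3 : X * X * X = (s : ℂ) • X) (h2 : (X * X).trace = 2 * s) :
    traceNorm X = 2 * √s := by
  rcases hs.eq_or_lt with rfl | hs
  · have : Xᴴ * X = 0 := by
      rw [hX.eq]
      have h4 : (X * X)ᴴ * (X * X) = 0 := by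
        rw [conjTranspose_mul, hX.eq, ← Matrix.mul_assoc, h3]; simp
      exact conjTranspose_mul_self_eq_zero.1 h4
    rw [conjTranspose_mul_self_eq_zero.1 this, traceNorm]; simp
  · have hr : 0 < √s := Real.sqrt_pos.2 hs
    have hps : (X * X).PosSemidef := by
      simpa only [hX.eq] using posSemidef_conjTranspose_mul_self X
    have : CFC.abs X = (((√s)⁻¹ : ℝ) : ℂ) • (X * X) := by
      refine CFC.sqrt_unique ?_ (hps.smul ?_).nonneg
      · rw [smul_mul_smul_comm, ← Matrix.mul_assoc, h3, smul_mul, smul_smul, star_eq_conjTranspose,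
          hX.eq]
        have : (((√s)⁻¹ : ℝ) : ℂ) * (((√s)⁻¹ : ℝ) : ℂ) * (s : ℂ) = 1 := by
          norm_cast
          rw [← mul_inv, Real.mul_self_sqrt hs.le, inv_mul_cancel₀ hs.ne']
        rw [this, one_smul]
      · exact_mod_cast (inv_pos.2 hr).le
    rw [traceNorm, this, trace_smul, h2, smul_eq_mul]
    norm_cast
    nth_rw 2 [← Real.mul_self_sqrt hs.le]
    field_simp

theorem traceDistance_vecMulVec [DecidableEq n] {v w : n → ℂ} (hv : star v ⬝ᵥ v = 1)
    (hw : star w ⬝ᵥ w = 1) :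
    traceDistance (vecMulVec v (star v)) (vecMulVec w (star w))
      = √(1 - ‖star v ⬝ᵥ w‖ ^ 2) := by
  set c := star v ⬝ᵥ w with hc
  have hc' : star w ⬝ᵥ v = star c := by rw [hc, star_dotProduct]
  have hcc : star c * c = ((‖c‖ ^ 2 : ℝ) : ℂ) := by
    rw [← Complex.normSq_eq_norm_sq, Complex.normSq_eq_conj_mul_self]; rfl
  have hle : 0 ≤ 1 - ‖c‖ ^ 2 := by
    have h1 := norm_inner_le_norm (𝕜 := ℂ) (WithLp.toLp 2 v) (WithLp.toLp 2 w)
    have hn (v : n → ℂ) (hv : star v ⬝ᵥ v = 1) : ‖WithLp.toLp 2 v‖ = 1 := by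
      rw [norm_eq_sqrt_re_inner (𝕜 := ℂ), EuclideanSpace.inner_toLp_toLp, dotProduct_comm, hv]
      simp
    rw [hn v hv, hn w hw, EuclideanSpace.inner_toLp_toLp, dotProduct_comm, ← hc] at h1
    nlinarith [norm_nonneg c]
  rw [traceDistance, traceNorm_of_cube_eq (s := 1 - ‖c‖ ^ 2) _ hle]
  · ring
  · simp only [mul_sub, sub_mul, vecMulVec_mul_vecMulVec, hv, hw, ← hc, hc', smul_mul,
      Complex.ofReal_sub, ← hcc, vecMulVec_smul, one_smul, sub_smul, smul_sub,
      Complex.ofReal_one, smul_smul]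
    simp only [mul_comm c]
    abel
  · simp only [mul_sub, sub_mul, vecMulVec_mul_vecMulVec, hv, hw, ← hc, hc', trace_sub,
      trace_smul, trace_vecMulVec, one_smul, vecMulVec_smul, Complex.ofReal_sub,
      ← hcc, dotProduct_comm _ (star _), smul_eq_mul, Complex.ofReal_one]
    ring
  · exact (posSemidef_vecMulVec_self_star v).isHermitian.sub
      (posSemidef_vecMulVec_self_star w).isHermitian

/-- The attained direction of Uhlmann's theorem. -/
theorem exists_trace_conjTranspose_mul_eq_fidelity [DecidableEq n] {ρ σ : Matrix n n ℂ}
    (hρ : ρ.PosSemidef) (hσ : σ.PosSemidef) :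
    ∃ P Q : Matrix n n ℂ, P * Pᴴ = ρ ∧ Q * Qᴴ = σ ∧ (Pᴴ * Q).trace = fidelity ρ σ := by
  obtain ⟨U, hU, h⟩ := exists_unitary_trace_mul_eq (CFC.sqrt ρ * CFC.sqrt σ)
  -- A unitary on the right does not change `Q * Qᴴ`, and this one turns the trace into the trace
  -- norm.
  refine ⟨CFC.sqrt ρ, CFC.sqrt σ * U, ?_, ?_, ?_⟩
  · rw [sqrt_conjTranspose, CFC.sqrt_mul_sqrt_self ρ hρ.nonneg]
  · rw [conjTranspose_mul, sqrt_conjTranspose, Matrix.mul_assoc, ← Matrix.mul_assoc U, hU, one_mul,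
      CFC.sqrt_mul_sqrt_self σ hσ.nonneg]
  · rw [sqrt_conjTranspose, ← Matrix.mul_assoc]; exact h

end MatrixLemmas

theorem IsPure.isDensity {A : Type u} [Fintype A] {ψ : Matrix A A ℂ} (h : IsPure ψ) :
    IsDensity ψ := by
  obtain ⟨v, hv, rfl⟩ := h
  exact ⟨posSemidef_vecMulVec_self_star v, by rw [trace_vecMulVec, dotProduct_comm, hv]⟩

theorem IsDensity.isSubnormalized {A : Type u} [Fintype A] {ρ : Matrix A A ℂ} (h : IsDensity ρ) :
    IsSubnormalized ρ :=
  ⟨h.1, by rw [h.2]; simp⟩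

theorem exists_eq_star_mul_self {B : Type*} [NonUnitalCStarAlgebra B] [PartialOrder B]
    [StarOrderedRing B] {b : B} (h : 0 ≤ b) : ∃ c, b = star c * c :=
  CStarAlgebra.nonneg_iff_eq_star_mul_self.1 h

theorem cstarMatrix_sum_apply {k κ B : Type*} [AddCommMonoid B] (s : Finset κ)
    (F : κ → CStarMatrix k k B) (i j : k) : (∑ x ∈ s, F x) i j = ∑ x ∈ s, F x i j := by
  induction s using Finset.cons_induction with
  | empty => simp
  | cons x s hx ih => rw [Finset.sum_cons, Finset.sum_cons, ← ih]; rfl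

/-! ### Completely positive maps and the lower bound. -/

section Channels

open scoped CStarAlgebra Matrix.Norms.L2Operator

variable {A R : Type u} [Fintype A] [DecidableEq A] [Fintype R] [DecidableEq R]

/-- The sum of the blocks of a matrix that are selected by the maps `f c : A → R`; a partial trace
if these maps are jointly bijective. -/
noncomputable def blockSum {ι : Type*} [Fintype ι] (f : ι → A → R) :
    Matrix R R ℂ →CP Matrix A A ℂ where
  toFun X := ∑ c, X.submatrix (f c) (f c)
  map_add' _ _ := Finset.sum_add_distrib
  map_smul' z X := (Finset.smul_sum (r := z) (f := fun c ↦ X.submatrix (f c) (f c))).symm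
  map_cstarMatrix_nonneg' k M hM := by
    rcases isEmpty_or_nonempty A with hA | ⟨⟨a₀⟩⟩
    · exact le_of_eq (CStarMatrix.ext fun i j ↦ Subsingleton.elim _ _)
    obtain ⟨C, rfl⟩ := exists_eq_star_mul_self hM
    -- Each row of `C`, restricted along `f c`, is stored in row `a₀` of an otherwise zero square
    -- matrix; the choice of `a₀` is immaterial.
    let D (c : ι) (r : R) : CStarMatrix (Fin k) (Fin k) (Matrix A A ℂ) :=
      CStarMatrix.ofMatrix fun l i ↦ vecMulVec (Pi.single a₀ 1) fun a ↦ C l i r (f c a)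
    have hD (c : ι) (r : R) (i j : Fin k) (a b : A) : (star (D c r) * D c r) i j a b
        = ∑ l, star (C l i r (f c a)) * C l j r (f c b) := by
      have (l i : Fin k) : D c r l i = vecMulVec (Pi.single a₀ 1) fun a ↦ C l i r (f c a) := rfl
      simp only [CStarMatrix.mul_apply, CStarMatrix.star_apply, this, star_eq_conjTranspose,
        conjTranspose_vecMulVec, vecMulVec_mul_vecMulVec, Matrix.sum_apply]
      simp [vecMulVec_apply]
    suffices h : (star C * C).map (fun X : Matrix R R ℂ ↦ ∑ c, X.submatrix (f c) (f c))
        = ∑ c, ∑ r, star (D c r) * D c r by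
      refine le_of_le_of_eq ?_ h.symm
      exact Finset.sum_nonneg fun c _ ↦ Finset.sum_nonneg fun r _ ↦ star_mul_self_nonneg _
    ext i j a b
    simp only [cstarMatrix_sum_apply, Matrix.sum_apply, hD]
    simp only [CStarMatrix.map_apply, CStarMatrix.mul_apply, CStarMatrix.star_apply,
      Matrix.sum_apply, submatrix_apply, star_eq_conjTranspose, Matrix.mul_apply,
      conjTranspose_apply]
    exact Finset.sum_congr rfl fun c _ ↦ Finset.sum_comm

@[simp]
theorem blockSum_apply {ι : Type*} [Fintype ι] (f : ι → A → R) (X : Matrix R R ℂ) :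
    blockSum f X = ∑ c, X.submatrix (f c) (f c) := rfl

/-- The block matrix of all `|xᵢ⟩⟨xⱼ|` is `star C * C`, where `C` has the single nonzero block row
`|v⟩⟨xᵢ|`. Its image under `E` is again positive, hence `star D * D`; the block columns of `D` are
`P` and `Q`. -/
theorem exists_gram_of_pure (E : Matrix R R ℂ →CP Matrix A A ℂ) {v : R → ℂ} (w : R → ℂ)
    (hv : star v ⬝ᵥ v = 1) :
    ∃ P Q : Matrix (Fin 2 × A) A ℂ, E (vecMulVec v (star v)) = Pᴴ * P ∧
      E (vecMulVec w (star w)) = Qᴴ * Q ∧ E (vecMulVec v (star w)) = Pᴴ * Q ∧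
      E (vecMulVec w (star v)) = Qᴴ * P := by
  let x : Fin 2 → R → ℂ := ![v, w]
  let C : CStarMatrix (Fin 2) (Fin 2) (Matrix R R ℂ) :=
    CStarMatrix.ofMatrix fun k i ↦ if k = 0 then vecMulVec v (star (x i)) else 0
  have hC (i j : Fin 2) : (star C * C) i j = vecMulVec (x i) (star (x j)) := by
    rw [CStarMatrix.mul_apply, Fin.sum_univ_two, CStarMatrix.star_apply, CStarMatrix.star_apply]
    have h0 (i : Fin 2) : C 0 i = vecMulVec v (star (x i)) := rfl
    have h1 (i : Fin 2) : C 1 i = 0 := rfl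
    simp [h0, h1, star_eq_conjTranspose, vecMulVec_mul_vecMulVec, hv, conjTranspose_vecMulVec]
  obtain ⟨D, hD⟩ := exists_eq_star_mul_self
    (E.map_cstarMatrix_nonneg (star C * C) (star_mul_self_nonneg C))
  let G (i : Fin 2) : Matrix (Fin 2 × A) A ℂ := Matrix.of fun p b ↦ D p.1 i p.2 b
  have hG (i j : Fin 2) : E (vecMulVec (x i) (star (x j))) = (G i)ᴴ * G j := by
    have := congrFun (congrFun hD i) j
    rw [CStarMatrix.map_apply, hC, CStarMatrix.mul_apply] at this
    rw [this]
    ext a b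
    simp [G, Matrix.sum_apply, Matrix.mul_apply, Fintype.sum_prod_type, CStarMatrix.star_apply,
      star_eq_conjTranspose]
  exact ⟨G 0, G 1, hG 0 0, hG 1 1, hG 0 1, hG 1 0⟩

theorem sq_norm_le_mul_of_forall {a c : ℝ} {b : ℂ} (ha : 0 ≤ a) (hc : 0 ≤ c)
    (h : ∀ z : ℂ, 0 ≤ a + 2 * (z * b).re + ‖z‖ ^ 2 * c) : ‖b‖ ^ 2 ≤ a * c := by
  rcases eq_or_ne b 0 with rfl | hb
  · simpa using mul_nonneg ha hc
  have hq (t : ℝ) : 0 ≤ (‖b‖ ^ 2 * c) * (t * t) + (2 * ‖b‖ ^ 2) * t + a := by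
    -- Along this line the form is a real quadratic in `t`, so its discriminant is nonpositive.
    have := h (t * star b)
    have h1 : (t * star b * b).re = t * ‖b‖ ^ 2 := by
      rw [mul_assoc, ← Complex.normSq_eq_norm_sq]
      have : star b * b = (Complex.normSq b : ℂ) := Complex.normSq_eq_conj_mul_self.symm
      rw [this]; norm_cast
    rw [h1, norm_mul, norm_star, Complex.norm_real, mul_pow, Real.norm_eq_abs, sq_abs] at this
    linarith
  have hd := discrim_le_zero hq
  have hb' : 0 < ‖b‖ ^ 2 := by positivity
  rw [discrim] at hd
  have : ‖b‖ ^ 2 * ‖b‖ ^ 2 ≤ ‖b‖ ^ 2 * (a * c) := by linarith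
  exact le_of_mul_le_mul_left this hb'

theorem norm_inner_le_generalizedFidelity (E : Matrix R R ℂ →CP Matrix A A ℂ)
    (hE : IsTraceNonincreasing E) {v w : R → ℂ} (hv : star v ⬝ᵥ v = 1) (hw : star w ⬝ᵥ w = 1) :
    ‖star v ⬝ᵥ w‖ ≤ generalizedFidelity (E (vecMulVec v (star v))) (E (vecMulVec w (star w))) := by
  obtain ⟨P, Q, hP, hQ, hPQ, hQP⟩ := exists_gram_of_pure E w hv
  have h1 : ‖(E (vecMulVec v (star w))).trace‖
      ≤ fidelity (E (vecMulVec v (star v))) (E (vecMulVec w (star w))) := by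
    rw [hPQ, hP, hQ]
    exact norm_trace_conjTranspose_mul_le_fidelity P Q
  -- The value of the defect functional `Tr X - Tr E(X)` at `|v⟩⟨w|`.
  set b := star w ⬝ᵥ v - (E (vecMulVec v (star w))).trace with hb
  have hb' : star v ⬝ᵥ w - (E (vecMulVec w (star v))).trace = star b := by
    rw [hb, star_sub, hPQ, hQP, ← trace_conjTranspose, conjTranspose_mul,
      conjTranspose_conjTranspose, star_dotProduct]
  have h2 : ‖b‖ ^ 2 ≤ (1 - (E (vecMulVec v (star v))).trace.re) *
      (1 - (E (vecMulVec w (star w))).trace.re) := by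
    have hdefect {u : R → ℂ} (hu : star u ⬝ᵥ u = 1) :
        0 ≤ 1 - (E (vecMulVec u (star u))).trace.re := by
      have := hE _ (posSemidef_vecMulVec_self_star u)
      rw [trace_vecMulVec, dotProduct_comm, hu] at this
      exact sub_nonneg.2 this
    refine sq_norm_le_mul_of_forall (hdefect hv) (hdefect hw) fun z ↦ ?_
    -- Nonnegativity of the defect at every `v + z̄ w` is the hypothesis for Cauchy–Schwarz.
    have h := sub_nonneg.2 <| hE _ (posSemidef_vecMulVec_self_star (v + star z • w))
    rw [← Complex.sub_re] at h
    refine h.trans_eq ?_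
    have : (vecMulVec (v + star z • w) (star (v + star z • w))).trace -
        (E (vecMulVec (v + star z • w) (star (v + star z • w)))).trace =
        (1 - (E (vecMulVec v (star v))).trace) + (z * b + star (z * b)) +
          star z * z * (1 - (E (vecMulVec w (star w))).trace) := by
      rw [star_mul', ← hb', hb]
      simp only [star_add, star_smul, star_star, add_vecMulVec, vecMulVec_add, smul_vecMulVec,
        vecMulVec_smul, map_add, map_smul, trace_add, trace_smul, trace_vecMulVec, smul_eq_mul,
        dotProduct_comm _ (star _), hv, hw]
      ring
    rw [this, Complex.add_re, Complex.add_re, Complex.sub_re, Complex.one_re]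
    have hz : star z * z = ((‖z‖ ^ 2 : ℝ) : ℂ) := by
      rw [← Complex.normSq_eq_norm_sq, Complex.normSq_eq_conj_mul_self]; rfl
    have hre : (z * b + star (z * b)).re = 2 * (z * b).re := by
      rw [Complex.add_re, Complex.star_def, Complex.conj_re]; ring
    rw [hz, hre, Complex.re_ofReal_mul, Complex.sub_re, Complex.one_re]
  have h3 : star v ⬝ᵥ w = star ((E (vecMulVec v (star w))).trace + b) := by
    rw [hb, add_sub_cancel, star_dotProduct]
  rw [h3, norm_star, generalizedFidelity]
  exact (norm_add_le _ _).trans (add_le_add h1 (Real.le_sqrt_of_sq_le h2))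

theorem purifiedDistance_le_traceDistance (E : Matrix R R ℂ →CP Matrix A A ℂ)
    (hE : IsTraceNonincreasing E) {ψ φ : Matrix R R ℂ} (hψ : IsPure ψ) (hφ : IsPure φ) :
    purifiedDistance (E ψ) (E φ) ≤ traceDistance ψ φ := by
  obtain ⟨v, hv, rfl⟩ := hψ
  obtain ⟨w, hw, rfl⟩ := hφ
  rw [traceDistance_vecMulVec hv hw, purifiedDistance]
  have := norm_inner_le_generalizedFidelity E hE hv hw
  gcongr

end Channels

/-! ### Optimal pure preimages. -/

section Purification

open scoped CStarAlgebra Matrix.Norms.L2Operator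

variable {A : Type u} [Fintype A]

theorem trace_mul_conjTranspose_re (P : Matrix A A ℂ) :
    (P * Pᴴ).trace = ((P * Pᴴ).trace.re : ℂ) :=
  Complex.ext rfl (Complex.nonneg_iff.1
    (posSemidef_self_mul_conjTranspose P).trace_nonneg).2.symm

/-- The vector on `A × A` whose coefficients are the entries of `P`, extended by a further
coefficient `x`. -/
def extendedVec (P : Matrix A A ℂ) (x : ℂ) : Option (A × A) → ℂ :=
  fun r ↦ r.elim x fun p ↦ P p.1 p.2

theorem star_extendedVec_dotProduct (P Q : Matrix A A ℂ) (x y : ℂ) :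
    star (extendedVec P x) ⬝ᵥ extendedVec Q y = star x * y + (Pᴴ * Q).trace := by
  simp only [dotProduct, Fintype.sum_option, Fintype.sum_prod_type, Matrix.trace, Matrix.mul_apply,
    extendedVec, Pi.star_apply, Option.elim, diag_apply, conjTranspose_apply]
  rw [Finset.sum_comm]

variable [DecidableEq A]

theorem blockSum_vecMulVec_extendedVec (P : Matrix A A ℂ) (x : ℂ) :
    blockSum (fun (c : A) (a : A) ↦ some (a, c))
      (vecMulVec (extendedVec P x) (star (extendedVec P x))) = P * Pᴴ := by
  ext a b
  simp [Matrix.sum_apply, Matrix.mul_apply, vecMulVec_apply, extendedVec]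

theorem isTraceNonincreasing_blockSum_some :
    IsTraceNonincreasing (blockSum fun (c : A) (a : A) ↦ some (a, c)) := by
  intro X hX
  have : X.trace = X none none + (blockSum (fun (c : A) (a : A) ↦ some (a, c)) X).trace := by
    simp only [Matrix.trace, blockSum_apply, diag_apply, Fintype.sum_option, Fintype.sum_prod_type,
      Matrix.sum_apply, submatrix_apply]
  rw [this, Complex.add_re]
  exact le_add_of_nonneg_left (Complex.nonneg_iff.1 hX.diag_nonneg).1

theorem isTracePreserving_blockSum :
    IsTracePreserving (blockSum fun (c : A) (a : A) ↦ (a, c)) := by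
  intro X
  simp only [Matrix.trace, blockSum_apply, diag_apply, Fintype.sum_prod_type, Matrix.sum_apply,
    submatrix_apply]

variable {ρ σ : Matrix A A ℂ}

theorem exists_pure_traceDistance_eq (hρ : IsSubnormalized ρ) (hσ : IsSubnormalized σ) :
    ∃ (ψ φ : Matrix (Option (A × A)) (Option (A × A)) ℂ)
      (E : Matrix (Option (A × A)) (Option (A × A)) ℂ →CP Matrix A A ℂ),
      IsPure ψ ∧ IsPure φ ∧ IsTraceNonincreasing E ∧ E ψ = ρ ∧ E φ = σ ∧
        traceDistance ψ φ = purifiedDistance ρ σ := by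
  obtain ⟨P, Q, hP, hQ, hPQ⟩ := exists_trace_conjTranspose_mul_eq_fidelity hρ.1 hσ.1
  -- The extra coefficient `√(1 - Tr τ)` restores unit norm; the product of two of them is the
  -- second term of the generalized fidelity.
  have hunit {τ P : Matrix A A ℂ} (hτ : IsSubnormalized τ) (hP : P * Pᴴ = τ) :
      star (extendedVec P √(1 - τ.trace.re)) ⬝ᵥ extendedVec P √(1 - τ.trace.re) = 1 := by
    rw [star_extendedVec_dotProduct, trace_mul_comm, trace_mul_conjTranspose_re, hP,
      Complex.star_def, Complex.conj_ofReal, ← Complex.ofReal_mul,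
      Real.mul_self_sqrt (sub_nonneg.2 hτ.2)]
    simp
  have hv := hunit hρ hP
  have hw := hunit hσ hQ
  refine ⟨_, _, blockSum fun (c : A) (a : A) ↦ some (a, c), ⟨_, hv, rfl⟩, ⟨_, hw, rfl⟩,
    isTraceNonincreasing_blockSum_some, ?_, ?_, ?_⟩
  · rw [blockSum_vecMulVec_extendedVec, hP]
  · rw [blockSum_vecMulVec_extendedVec, hQ]
  · rw [traceDistance_vecMulVec hv hw, purifiedDistance, star_extendedVec_dotProduct, hPQ,
      Complex.star_def, Complex.conj_ofReal, ← Complex.ofReal_mul,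
      ← Real.sqrt_mul (sub_nonneg.2 hρ.2), ← Complex.ofReal_add, Complex.norm_real,
      Real.norm_eq_abs, sq_abs, add_comm, generalizedFidelity]

/-- With no missing trace the extra coordinate is unnecessary, and the map is a genuine partial
trace, as data processing under channels requires. -/
theorem exists_pure_traceDistance_eq_of_isDensity (hρ : IsDensity ρ) (hσ : IsDensity σ) :
    ∃ (ψ φ : Matrix (A × A) (A × A) ℂ) (E : Matrix (A × A) (A × A) ℂ →CP Matrix A A ℂ),
      IsPure ψ ∧ IsPure φ ∧ IsTracePreserving E ∧ E ψ = ρ ∧ E φ = σ ∧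
        traceDistance ψ φ = purifiedDistance ρ σ := by
  obtain ⟨P, Q, hP, hQ, hPQ⟩ := exists_trace_conjTranspose_mul_eq_fidelity hρ.1 hσ.1
  have hdot (P Q : Matrix A A ℂ) :
      star (fun p : A × A ↦ P p.1 p.2) ⬝ᵥ (fun p : A × A ↦ Q p.1 p.2) = (Pᴴ * Q).trace := by
    simp only [dotProduct, Fintype.sum_prod_type, Matrix.trace, Matrix.mul_apply,
      Pi.star_apply, diag_apply, conjTranspose_apply]
    rw [Finset.sum_comm]
  have hblock (P : Matrix A A ℂ) : blockSum (fun (c : A) (a : A) ↦ (a, c))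
      (vecMulVec (fun p : A × A ↦ P p.1 p.2) (star fun p : A × A ↦ P p.1 p.2)) = P * Pᴴ := by
    ext a b
    simp [Matrix.sum_apply, Matrix.mul_apply, vecMulVec_apply]
  have hv := (hdot P P).trans ((trace_mul_comm _ _).trans ((congrArg _ hP).trans hρ.2))
  have hw := (hdot Q Q).trans ((trace_mul_comm _ _).trans ((congrArg _ hQ).trans hσ.2))
  refine ⟨_, _, blockSum fun (c : A) (a : A) ↦ (a, c), ⟨_, hv, rfl⟩, ⟨_, hw, rfl⟩,
    isTracePreserving_blockSum, (hblock P).trans hP, (hblock Q).trans hQ, ?_⟩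
  rw [traceDistance_vecMulVec hv hw, hdot, hPQ, Complex.norm_real, Real.norm_eq_abs, sq_abs,
    purifiedDistance, generalizedFidelity, hρ.2]
  simp

end Purification

end QState

theorem mainTheorem7 :
    (∀ (A : Type u) [Fintype A] [DecidableEq A] (ρ σ : Matrix A A ℂ),
      QState.IsSubnormalized ρ → QState.IsSubnormalized σ →
        QState.maximalExtension (fun _ _ _ ψ φ => QState.traceDistance ψ φ) ρ σ =
          (QState.purifiedDistance ρ σ : EReal)) ∧
    (∀ M : ∀ (A : Type u) [Fintype A] [DecidableEq A], Matrix A A ℂ → Matrix A A ℂ → EReal,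
      QState.SubnormalizedDPI M → QState.ReducesToTraceDistance M →
        ∀ (A : Type u) [Fintype A] [DecidableEq A] (ρ σ : Matrix A A ℂ),
          QState.IsSubnormalized ρ → QState.IsSubnormalized σ →
            M A ρ σ ≤ (QState.purifiedDistance ρ σ : EReal)) ∧
    (∀ M : ∀ (A : Type u) [Fintype A] [DecidableEq A], Matrix A A ℂ → Matrix A A ℂ → EReal,
      QState.NormalizedDPI M → QState.ReducesToTraceDistance M →
        ∀ (A : Type u) [Fintype A] [DecidableEq A] (ρ σ : Matrix A A ℂ),
          QState.IsDensity ρ → QState.IsDensity σ →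
            M A ρ σ ≤ (QState.purifiedDistance ρ σ : EReal)) := by
  refine ⟨fun A _ _ ρ σ hρ hσ ↦ le_antisymm ?_ ?_, fun M hM hD A _ _ ρ σ hρ hσ ↦ ?_,
    fun M hM hD A _ _ ρ σ hρ hσ ↦ ?_⟩
  · obtain ⟨ψ, φ, E, hψ, hφ, hE, h₁, h₂, h⟩ := QState.exists_pure_traceDistance_eq hρ hσ
    exact sInf_le ⟨_, inferInstance, inferInstance, ψ, φ, E, hψ, hφ, hE, h₁, h₂,
      congrArg _ h.symm⟩
  · refine le_sInf ?_
    rintro _ ⟨R, _, _, ψ, φ, E, hψ, hφ, hE, rfl, rfl, rfl⟩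
    exact EReal.coe_le_coe_iff.2 (QState.purifiedDistance_le_traceDistance E hE hψ hφ)
  · obtain ⟨ψ, φ, E, hψ, hφ, hE, rfl, rfl, h⟩ := QState.exists_pure_traceDistance_eq hρ hσ
    rw [← h, ← hD _ ψ φ hψ hφ]
    exact hM _ _ E hE ψ φ hψ.isDensity.isSubnormalized hφ.isDensity.isSubnormalized
  · obtain ⟨ψ, φ, E, hψ, hφ, hE, rfl, rfl, h⟩ :=
      QState.exists_pure_traceDistance_eq_of_isDensity hρ hσ
    rw [← h, ← hD _ ψ φ hψ hφ]
    exact hM _ _ E hE ψ φ hψ.isDensity hφ.isDensity
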